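/- Let $\Bbbk$ be a field, $n \ge 0$, $R = \Bbbk[x_0,\dots,x_n]$, and let $I \subset R$ be a monomial ideal with $I \neq 0$ and $I \neq R$. Let $\operatorname{Ass}(I)$ be the set of associated primes of $I$ (that is, of $R/I$), and let $\operatorname{maxAss}(I)$ be the set of its elements that are maximal with respect to inclusion. For $m \in \mathbb N = \{0,1,2,\dots\}$ the $m$-th symbolic power of $I$ is $$I^{(m)} = R \cap \bigcap_{P \in \operatorname{Ass}(I)} I^m R_P .$$ The symbolic polyhedron of $I$ is $$\mathcal Q = \bigcap_{P \in \operatorname{maxAss}(I)} \operatorname{conv}\bigl\{\mathbf a \in \mathbb N^{n+1} : \mathbf x^{\mathbf a} \in R \cap I R_P\bigr\} \subseteq \mathbb R^{n+1}.$$ Put $\alpha(\mathcal Q) = \min\{a_0 + \cdots + a_n : \mathbf a \in \mathcal Q\}$, and for an ideal $J$ of $R$ let $\alpha(J)$ be the least degree of a non-zero homogeneous polynomial in $J$. Then these minima exist for $\mathcal Q$ and for every $J = I^{(m)}$, we have $$\alpha(I^{(m)}) \ge m\,\alpha(\mathcal Q) \quad \text{for all } m \in \mathbb N,$$ and equality holds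 for infinitely many $m$. -/

import Mathlib

open MvPolynomial

namespace SymbolicPolyhedron

section CommRing

variable {R : Type*} [CommRing R]

/-- `R ∩ J R_P`: the preimage in `R` of the extension of the ideal `J` to the localization of `R`
at the prime ideal `P`. -/
noncomputable def localContraction (J P : Ideal R) [P.IsPrime] : Ideal R :=
  (J.map (algebraMap R (Localization.AtPrime P))).comap (algebraMap R (Localization.AtPrime P))

/-- The set `Ass(I)` of associated primes of the ideal `I`, i.e. of the `R`-module `R / I`. -/
def ass (I : Ideal R) : Set (Ideal R) :=
  associatedPrimes R (R ⧸ I)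

theorem isPrime_of_mem_ass {I P : Ideal R} (hP : P ∈ ass I) : P.IsPrime :=
  IsAssociatedPrime.isPrime hP

/-- The set `maxAss(I)` of those associated primes of `I` that are maximal (with respect to
inclusion) among the associated primes of `I`. -/
def maxAss (I : Ideal R) : Set (Ideal R) :=
  {P | Maximal (fun P' => P' ∈ ass I) P}

theorem isPrime_of_mem_maxAss {I P : Ideal R} (hP : P ∈ maxAss I) : P.IsPrime :=
  isPrime_of_mem_ass hP.prop

/-- The `m`-th symbolic power `I^(m) = R ∩ ⋂_{P ∈ Ass(I)} I^m R_P`. -/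
noncomputable def symbolicPower (I : Ideal R) (m : ℕ) : Ideal R :=
  ⨅ (P : Ideal R) (hP : P ∈ ass I),
    haveI : P.IsPrime := isPrime_of_mem_ass hP
    localContraction (I ^ m) P

end CommRing

section Polynomial

variable {σ k : Type*} [Field k]

/-- A monomial ideal: an ideal generated by a set of monomials. -/
def IsMonomialIdeal (I : Ideal (MvPolynomial σ k)) : Prop :=
  ∃ S : Set (σ →₀ ℕ), I = Ideal.span ((fun a => monomial a (1 : k)) '' S)

/-- The set of exponent vectors of the monomials in `I`, as a subset of real affine space. -/
def latticePoints (I : Ideal (MvPolynomial σ k)) : Set (σ → ℝ) :=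
  {x | ∃ a : σ →₀ ℕ, monomial a (1 : k) ∈ I ∧ x = fun i => (a i : ℝ)}

/-- The symbolic polyhedron of `I`: the intersection, over the maximal associated primes `P` of
`I`, of the convex hulls of the exponent vectors of the monomials in `R ∩ I R_P`. -/
noncomputable def symbolicPolyhedron (I : Ideal (MvPolynomial σ k)) : Set (σ → ℝ) :=
  ⋂ (P : Ideal (MvPolynomial σ k)) (hP : P ∈ maxAss I),
    haveI : P.IsPrime := isPrime_of_mem_maxAss hP
    convexHull ℝ (latticePoints (localContraction I P))

/-- The set of degrees `d` for which `I` contains a non-zero form of degree `d`. -/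
def formDegrees (I : Ideal (MvPolynomial σ k)) : Set ℕ :=
  {d | ∃ f ∈ I, f ≠ 0 ∧ f.IsHomogeneous d}

/-- The initial degree `α(I)`: the least degree of a non-zero form in `I`. -/
noncomputable def initialDegree (I : Ideal (MvPolynomial σ k)) : ℕ :=
  sInf (formDegrees I)

end Polynomial

/-- The set of values on `Q` of the linear form `a ↦ a · (1, …, 1)`. -/
def coordSums {σ : Type*} [Fintype σ] (Q : Set (σ → ℝ)) : Set ℝ :=
  (fun a => ∑ i, a i) '' Q

/-- `α(Q)`, the minimum of the coordinate sums of the points of `Q`. -/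
noncomputable def minCoordSum {σ : Type*} [Fintype σ] (Q : Set (σ → ℝ)) : ℝ :=
  sInf (coordSums Q)

end SymbolicPolyhedron

/-!
Write `L_P` for the set of exponents of the monomials in `R ∩ I R_P`, `Q` for the symbolic
polyhedron and `α` for the minimum of the coordinate sum on `Q`.

The contraction `R ∩ J R_P` of a monomial ideal `J` at any prime `P` is again a monomial ideal, and
`x^a` belongs to it if and only if `x^b x^a ∈ J` for some monomial `x^b ∉ P`
(`IsMonomialIdeal.exists_primePart_eq_zero`). It follows that every monomial in `R ∩ I^m R_P` has
an exponent which is a sum of `m` elements of `L_P`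
(`IsMonomialIdeal.exists_add_of_mem_localContraction_pow_succ`). As only the maximal associated
primes matter for the symbolic powers (`mem_symbolicPower`), the exponents occurring in `I^(m)`,
divided by `m`, are points of `Q`, and this gives the lower bound for the initial degree.

The minimum `α` exists because `Q` is closed in the non-negative orthant: by Dickson's lemma, the
convex hull of `L_P` is the sum of a polytope and the orthant
(`isClosed_convexHull_latticePoints`).

For equality, a minimizing point `y` of `Q` has to be replaced by a rational one
(`exists_multiset_sum_of_isLeast`). For each of the finitely many `P`, write `y` as a convex
combination of points of `L_P` with positive real weights. There is a `ℚ`-linear map `φ : ℝ → ℚ`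
sending all these weights, and `1`, to positive integers (`exists_linearMap_pos_nat`). With
`N = φ 1`, the vector `a = φ(y)` is then a sum of `N` elements of `L_P` for each `P`, so
`a / N ∈ Q`. For small `ε > 0` the weights of `y - ε a` remain positive, so `y - ε a` lies in
`(1 - ε N) Q`; minimality of `y` forces the coordinate sum of `a` to be `N α`. Now `x^(j a)` lies in
`I^(N j)` (symbolic power) for every `j`, and its degree attains the lower bound.
-/

namespace SymbolicPolyhedron

/-! ### Rational approximation of positive real weights -/

/-- Finitely many positive reals are mapped to positive rationals by some `ℚ`-linear map. -/
theorem exists_linearMap_pos {T : Set ℝ} (hT : T.Finite) (hpos : ∀ x ∈ T, 0 < x) :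
    ∃ φ : ℝ →ₗ[ℚ] ℚ, ∀ x ∈ T, 0 < φ x := by
  -- A Hamel basis `B` of `ℝ`; `Ψ x ρ` is the value at `x` of the map `B i ↦ ρ i`. The identity
  -- of `ℝ` corresponds to `ρ = B`, and a rational point `ρ` near it is wanted.
  let B := Module.Basis.ofVectorSpace ℚ ℝ
  let Ψ : ℝ → (Module.Basis.ofVectorSpaceIndex ℚ ℝ → ℝ) → ℝ :=
    fun x ρ => (B.repr x).sum fun i q => q • ρ i
  have hΨ : ∀ x, Continuous (Ψ x) := fun x => by
    simp only [Ψ, Finsupp.sum, Rat.smul_def]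
    exact continuous_finsetSum _ fun i _ => continuous_const.mul (continuous_apply i)
  have hopen : IsOpen (⋂ x ∈ T, {ρ | 0 < Ψ x ρ}) :=
    hT.isOpen_biInter fun x _ => isOpen_lt continuous_const (hΨ x)
  have hne : (⋂ x ∈ T, {ρ | 0 < Ψ x ρ}).Nonempty := by
    refine ⟨fun i => B i, Set.mem_iInter₂.2 fun x hx => ?_⟩
    have : Ψ x (fun i => B i) = x := B.linearCombination_repr x
    rw [Set.mem_ofPred_eq, this]
    exact hpos x hx
  have hdense : DenseRange (Pi.map fun (_ : Module.Basis.ofVectorSpaceIndex ℚ ℝ) (q : ℚ) =>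
      (q : ℝ)) := DenseRange.piMap fun _ => Rat.isDenseEmbedding_coe_real.dense
  obtain ⟨r, hr⟩ := hdense.exists_mem_open hopen hne
  refine ⟨B.constr ℚ r, fun x hx => ?_⟩
  have h : 0 < Ψ x (fun i => (r i : ℝ)) := Set.mem_iInter₂.1 hr x hx
  have h' : Ψ x (fun i => (r i : ℝ)) = ((B.constr ℚ r x : ℚ) : ℝ) := by
    simp only [Ψ, Module.Basis.constr_apply, Finsupp.sum, Rat.cast_sum, Rat.smul_def, smul_eq_mul,
      Rat.cast_mul]
  rw [h'] at h
  exact_mod_cast h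

/-- Finitely many positive reals are mapped to positive integers by some `ℚ`-linear map
`ℝ → ℚ`. -/
theorem exists_linearMap_pos_nat {T : Set ℝ} (hT : T.Finite) (hpos : ∀ x ∈ T, 0 < x) :
    ∃ φ : ℝ →ₗ[ℚ] ℚ, ∀ x ∈ T, 0 < φ x ∧ ∃ n : ℕ, φ x = n := by
  obtain ⟨φ, hφ⟩ := exists_linearMap_pos hT hpos
  set D : ℕ := ∏ x ∈ hT.toFinset, (φ x).den
  have hD0 : 0 < D := Finset.prod_pos fun x _ => (φ x).den_pos
  refine ⟨(D : ℚ) • φ, fun x hx => ⟨?_, ?_⟩⟩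
  · have := hφ x hx
    simp only [LinearMap.smul_apply, smul_eq_mul]
    positivity
  · obtain ⟨e, he⟩ : (φ x).den ∣ D := Finset.dvd_prod_of_mem _ (hT.mem_toFinset.2 hx)
    refine ⟨e * (φ x).num.toNat, ?_⟩
    have hnum : (((φ x).num.toNat : ℤ) : ℚ) = (φ x).num := by
      rw [Int.toNat_of_nonneg (Rat.num_nonneg.2 (hφ x hx).le)]
    have hmul := Rat.den_mul_eq_num (φ x)
    simp only [LinearMap.smul_apply, smul_eq_mul, he, Nat.cast_mul]
    rw [← Int.cast_natCast (φ x).num.toNat, hnum, ← hmul]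
    ring

theorem exists_pos_forall_mul_lt {T : Set ℝ} (hT : T.Finite) (hpos : ∀ x ∈ T, 0 < x)
    (ψ : ℝ → ℝ) : ∃ ε : ℝ, 0 < ε ∧ ∀ x ∈ T, ε * ψ x < x := by
  have h : ∀ᶠ ε : ℝ in nhdsWithin 0 (Set.Ioi 0), ∀ x ∈ T, ε * ψ x < x := by
    refine (Filter.eventually_all_finite hT).2 fun x hx => ?_
    refine Filter.Eventually.filter_mono nhdsWithin_le_nhds ?_
    have : Continuous fun ε : ℝ => ε * ψ x := by fun_prop
    exact this.continuousAt.eventually_lt continuousAt_const (by simpa using hpos x hx)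
  obtain ⟨ε, hε, hε0⟩ := (h.and self_mem_nhdsWithin).exists
  exact ⟨ε, hε0, hε⟩

/-! ### Contractions of localizations -/

section CommRing

variable {R : Type*} [CommRing R]

theorem mem_localContraction {J P : Ideal R} [P.IsPrime] {f : R} :
    f ∈ localContraction J P ↔ ∃ s ∉ P, s * f ∈ J := by
  unfold localContraction
  rw [Ideal.mem_comap, IsLocalization.algebraMap_mem_map_algebraMap_iff P.primeCompl]
  rfl

theorem le_localContraction (J P : Ideal R) [P.IsPrime] : J ≤ localContraction J P :=
  Ideal.le_comap_map

theorem localContraction_anti (J : Ideal R) {P P' : Ideal R} [P.IsPrime] [P'.IsPrime]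
    (h : P ≤ P') : localContraction J P' ≤ localContraction J P := by
  intro f hf
  obtain ⟨s, hs, hsf⟩ := mem_localContraction.1 hf
  exact mem_localContraction.2 ⟨s, fun h' => hs (h h'), hsf⟩

theorem localContraction_pow_le (J P : Ideal R) [P.IsPrime] (m : ℕ) :
    localContraction J P ^ m ≤ localContraction (J ^ m) P := by
  unfold localContraction
  rw [Ideal.map_pow]
  exact Ideal.le_comap_pow _ m

theorem exists_mem_maxAss_ge [IsNoetherianRing R] {I P : Ideal R} (hP : P ∈ ass I) :
    ∃ P' ∈ maxAss I, P ≤ P' := by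
  obtain ⟨P', h, h'⟩ := (associatedPrimes.finite R (R ⧸ I)).exists_le_maximal hP
  exact ⟨P', h', h⟩

theorem finite_maxAss [IsNoetherianRing R] (I : Ideal R) : (maxAss I).Finite :=
  (associatedPrimes.finite R (R ⧸ I)).subset fun _ hP => hP.prop

theorem nonempty_maxAss [IsNoetherianRing R] {I : Ideal R} (hI : I ≠ ⊤) :
    (maxAss I).Nonempty := by
  have : Nontrivial (R ⧸ I) := Ideal.Quotient.nontrivial_iff.2 hI
  obtain ⟨P, hP⟩ := associatedPrimes.nonempty R (R ⧸ I)
  obtain ⟨P', h, -⟩ := exists_mem_maxAss_ge (I := I) hP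
  exact ⟨P', h⟩

/-- Only the maximal associated primes matter in the definition of the symbolic powers. -/
theorem mem_symbolicPower [IsNoetherianRing R] {I : Ideal R} {m : ℕ} {f : R} :
    f ∈ symbolicPower I m ↔ ∀ (P : Ideal R) (hP : P ∈ maxAss I),
      haveI : P.IsPrime := isPrime_of_mem_maxAss hP
      f ∈ localContraction (I ^ m) P := by
  simp only [symbolicPower, Submodule.mem_iInf]
  refine ⟨fun h P hP => h P hP.prop, fun h P hP => ?_⟩
  obtain ⟨P', hP', hle⟩ := exists_mem_maxAss_ge hP
  have := isPrime_of_mem_ass hP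
  have := isPrime_of_mem_maxAss hP'
  exact localContraction_anti _ hle (h P' hP')

theorem pow_le_symbolicPower [IsNoetherianRing R] (I : Ideal R) (m : ℕ) :
    I ^ m ≤ symbolicPower I m := by
  intro f hf
  rw [mem_symbolicPower]
  intro P hP
  have := isPrime_of_mem_maxAss hP
  exact le_localContraction _ _ hf

end CommRing

/-! ### Monomial ideals -/

section Monomial

variable {σ k : Type*} [Field k]

theorem mem_support_monomial_one (a : σ →₀ ℕ) : a ∈ (monomial a (1 : k)).support := by
  classical
  rw [mem_support_iff, coeff_monomial, if_pos rfl]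
  exact one_ne_zero

theorem monomial_mem_of_le {J : Ideal (MvPolynomial σ k)} {a b : σ →₀ ℕ} (hab : a ≤ b)
    (ha : monomial a (1 : k) ∈ J) : monomial b (1 : k) ∈ J := by
  rw [← tsub_add_cancel_of_le hab, ← one_mul (1 : k), ← monomial_mul]
  exact J.mul_mem_left _ ha

theorem IsMonomialIdeal.monomial_mem {J : Ideal (MvPolynomial σ k)} (hJ : IsMonomialIdeal J)
    {f : MvPolynomial σ k} (hf : f ∈ J) {a : σ →₀ ℕ} (ha : a ∈ f.support) :
    monomial a (1 : k) ∈ J := by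
  obtain ⟨S, rfl⟩ := hJ
  obtain ⟨b, hb, hba⟩ := mem_ideal_span_monomial_image.1 hf a ha
  exact monomial_mem_of_le hba (Ideal.subset_span ⟨b, hb, rfl⟩)

theorem IsMonomialIdeal.exists_monomial_mem {J : Ideal (MvPolynomial σ k)}
    (hJ : IsMonomialIdeal J) (h0 : J ≠ ⊥) : ∃ a, monomial a (1 : k) ∈ J := by
  obtain ⟨f, hf, hf0⟩ := Submodule.exists_mem_ne_zero_of_ne_bot h0
  obtain ⟨a, ha⟩ := Finset.nonempty_of_ne_empty (mt support_eq_empty.1 hf0)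
  exact ⟨a, hJ.monomial_mem hf ha⟩

open scoped Pointwise in
theorem span_monomial_mul (S T : Set (σ →₀ ℕ)) :
    Ideal.span ((fun a => monomial a (1 : k)) '' S) *
        Ideal.span ((fun a => monomial a (1 : k)) '' T) =
      Ideal.span ((fun a => monomial a (1 : k)) '' (S + T)) := by
  rw [Ideal.span_mul_span', ← Set.image2_mul, ← Set.image2_add, Set.image_image2,
    Set.image2_image_left, Set.image2_image_right]
  simp only [monomial_mul, one_mul]

theorem IsMonomialIdeal.mul {J K : Ideal (MvPolynomial σ k)} (hJ : IsMonomialIdeal J)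
    (hK : IsMonomialIdeal K) : IsMonomialIdeal (J * K) := by
  obtain ⟨S, rfl⟩ := hJ
  obtain ⟨T, rfl⟩ := hK
  exact ⟨_, span_monomial_mul S T⟩

theorem IsMonomialIdeal.pow {J : Ideal (MvPolynomial σ k)} (hJ : IsMonomialIdeal J) (m : ℕ) :
    IsMonomialIdeal (J ^ m) := by
  induction m with
  | zero =>
    refine ⟨{0}, ?_⟩
    rw [pow_zero, Ideal.one_eq_top, Set.image_singleton, eq_comm, Ideal.eq_top_iff_one]
    exact Ideal.subset_span rfl
  | succ m ih => rw [pow_succ]; exact ih.mul hJ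

theorem IsMonomialIdeal.exists_add_of_mem_mul {J K : Ideal (MvPolynomial σ k)}
    (hJ : IsMonomialIdeal J) (hK : IsMonomialIdeal K) {v : σ →₀ ℕ}
    (hv : monomial v (1 : k) ∈ J * K) :
    ∃ p q, monomial p (1 : k) ∈ J ∧ monomial q (1 : k) ∈ K ∧ v = p + q := by
  obtain ⟨S, rfl⟩ := hJ
  obtain ⟨T, rfl⟩ := hK
  rw [span_monomial_mul, mem_ideal_span_monomial_image] at hv
  obtain ⟨_, ⟨p, hp, q, hq, rfl⟩, hle⟩ := hv v (mem_support_monomial_one v)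
  refine ⟨p, v - p, Ideal.subset_span ⟨p, hp, rfl⟩,
    monomial_mem_of_le ?_ (Ideal.subset_span ⟨q, hq, rfl⟩), ?_⟩
  · exact le_tsub_of_add_le_left hle
  · exact (add_tsub_cancel_of_le (le_self_add.trans hle)).symm

end Monomial

/-! ### Localizing a monomial ideal at a prime -/

section PrimePart

variable {σ k : Type*} [Field k]

open scoped Classical in
/-- The part of an exponent vector `a` supported on the variables that lie in `P`. The monomial
`x^a` decomposes as `x^(primePart P a)` times a monomial outside `P`, if `P` is prime. -/
noncomputable def primePart (P : Ideal (MvPolynomial σ k)) (a : σ →₀ ℕ) : σ →₀ ℕ :=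
  a.filter fun i => (X i : MvPolynomial σ k) ∈ P

theorem primePart_add (P : Ideal (MvPolynomial σ k)) (a b : σ →₀ ℕ) :
    primePart P (a + b) = primePart P a + primePart P b :=
  by classical exact Finsupp.filter_add

theorem primePart_le (P : Ideal (MvPolynomial σ k)) (a : σ →₀ ℕ) : primePart P a ≤ a := by
  classical
  intro i
  rw [primePart, Finsupp.filter_apply]
  split_ifs <;> simp

theorem primePart_idem (P : Ideal (MvPolynomial σ k)) (a : σ →₀ ℕ) :
    primePart P (primePart P a) = primePart P a := by
  classical
  ext i
  simp only [primePart, Finsupp.filter_apply]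
  split_ifs <;> rfl

theorem monomial_notMem_iff {P : Ideal (MvPolynomial σ k)} [hP : P.IsPrime] {a : σ →₀ ℕ} :
    monomial a (1 : k) ∉ P ↔ primePart P a = 0 := by
  classical
  rw [monomial_eq, C_1, one_mul, Finsupp.prod, hP.prod_mem_iff, primePart,
    Finsupp.filter_eq_zero_iff]
  push Not
  refine ⟨fun h i hi => ?_, fun h i hi hi' => ?_⟩
  · by_contra h0
    exact h i (Finsupp.mem_support_iff.2 h0)
      (Ideal.pow_mem_of_mem P hi _ (Nat.pos_of_ne_zero h0))
  · exact Finsupp.mem_support_iff.1 hi (h i (hP.mem_of_pow_mem _ hi'))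

theorem primePart_sub_primePart (P : Ideal (MvPolynomial σ k)) (a : σ →₀ ℕ) :
    primePart P (a - primePart P a) = 0 := by
  have h := congrArg (primePart P) (tsub_add_cancel_of_le (primePart_le P a))
  rw [primePart_add, primePart_idem] at h
  exact add_eq_right.1 h

theorem monomial_mem_localContraction {J P : Ideal (MvPolynomial σ k)} [P.IsPrime]
    {a b : σ →₀ ℕ} (hb : primePart P b = 0) (hab : monomial (b + a) (1 : k) ∈ J) :
    monomial a (1 : k) ∈ localContraction J P := by
  refine mem_localContraction.2 ⟨monomial b 1, monomial_notMem_iff.2 hb, ?_⟩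
  rwa [monomial_mul, one_mul]

theorem monomial_primePart_mem {J P : Ideal (MvPolynomial σ k)} [P.IsPrime]
    {a : σ →₀ ℕ} (ha : monomial a (1 : k) ∈ J) :
    monomial (primePart P a) (1 : k) ∈ localContraction J P := by
  refine monomial_mem_localContraction (primePart_sub_primePart P a) ?_
  rwa [tsub_add_cancel_of_le (primePart_le P a)]

/-- If a multiple `s * f` with `s ∉ P` lies in the monomial ideal `J`, then every monomial of `f`
can be brought into `J` by a *monomial* outside `P`. The prime ideal `P` need not be monomial. -/
theorem IsMonomialIdeal.exists_primePart_eq_zero {J P : Ideal (MvPolynomial σ k)} [P.IsPrime]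
    (hJ : IsMonomialIdeal J) {f : MvPolynomial σ k} (hf : f ∈ localContraction J P)
    {a : σ →₀ ℕ} (ha : a ∈ f.support) :
    ∃ b, primePart P b = 0 ∧ monomial (b + a) (1 : k) ∈ J := by
  classical
  obtain ⟨s, hs, hsf⟩ := mem_localContraction.1 hf
  by_contra hbad
  set good : (σ →₀ ℕ) → Prop := fun a => ∃ b, primePart P b = 0 ∧ monomial (b + a) (1 : k) ∈ J
  -- Among the monomials of `f` violating the claim, keep those of least degree in the variables
  -- belonging to `P`.
  obtain ⟨d, hd, hdmin⟩ := Finset.exists_min_image (f.support.filter fun a => ¬ good a)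
    (fun a => (primePart P a).degree) ⟨a, Finset.mem_filter.2 ⟨ha, hbad⟩⟩
  set A := (f.support.filter fun a => ¬ good a).filter
    (fun a => (primePart P a).degree = (primePart P d).degree)
  set C := s.support.filter (fun c => primePart P c = 0)
  have hCne : C.Nonempty := by
    by_contra hne
    rw [Finset.not_nonempty_iff_eq_empty] at hne
    refine hs ?_
    rw [s.as_sum]
    refine Ideal.sum_mem _ fun c hc => ?_
    have hcP : monomial c (1 : k) ∈ P := by
      by_contra hcP
      have : c ∈ C := Finset.mem_filter.2 ⟨hc, monomial_notMem_iff.1 hcP⟩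
      simp [hne] at this
    rw [← mul_one (coeff c s), ← C_mul_monomial]
    exact P.mul_mem_left _ hcP
  obtain ⟨c₀, hc₀, a₀, ha₀, huniq⟩ := UniqueSums.uniqueAdd_of_nonempty hCne
    (show A.Nonempty from ⟨d, Finset.mem_filter.2 ⟨hd, rfl⟩⟩)
  obtain ⟨hc₀s, hc₀P⟩ := Finset.mem_filter.1 hc₀
  obtain ⟨ha₀', ha₀d⟩ := Finset.mem_filter.1 ha₀
  obtain ⟨ha₀f, ha₀bad⟩ := Finset.mem_filter.1 ha₀'
  -- The product of the terms of exponents `c₀` and `a₀` is not cancelled in `s * f`.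
  have huniq' : UniqueAdd s.support f.support c₀ a₀ := by
    intro c a hc ha h
    have hbada : ¬ good a := by
      rintro ⟨b, hb, hba⟩
      refine ha₀bad ⟨b + c₀, by rw [primePart_add, hb, hc₀P, add_zero], ?_⟩
      rw [add_assoc, ← h]
      exact monomial_mem_of_le (add_le_add_right le_add_self b) hba
    have hmin := hdmin a (Finset.mem_filter.2 ⟨ha, hbada⟩)
    have hdeg := congrArg (fun v => (primePart P v).degree) h
    simp only [primePart_add, map_add, hc₀P, ha₀d, zero_add] at hdeg
    have hc0 : (primePart P c).degree = 0 := by omega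
    refine huniq (Finset.mem_filter.2 ⟨hc, (Finsupp.degree_eq_zero_iff _).1 hc0⟩)
      (Finset.mem_filter.2 ⟨Finset.mem_filter.2 ⟨ha, hbada⟩, by omega⟩) h
  have hcoeff : coeff (c₀ + a₀) (s * f) = coeff c₀ s * coeff a₀ f := by
    rw [coeff_mul, Finset.sum_eq_single (c₀, a₀)]
    · rintro ⟨c, a⟩ hca hne
      by_contra h0
      refine hne (Prod.ext_iff.2 (huniq' (mem_support_iff.2 (left_ne_zero_of_mul h0))
        (mem_support_iff.2 (right_ne_zero_of_mul h0)) ?_))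
      simpa using hca
    · intro h
      simp at h
  refine ha₀bad ⟨c₀, hc₀P, hJ.monomial_mem hsf (mem_support_iff.2 ?_)⟩
  rw [hcoeff]
  exact mul_ne_zero (mem_support_iff.1 hc₀s) (mem_support_iff.1 ha₀f)

theorem IsMonomialIdeal.monomial_mem_localContraction_of_mem {J P : Ideal (MvPolynomial σ k)}
    [P.IsPrime] (hJ : IsMonomialIdeal J) {f : MvPolynomial σ k} (hf : f ∈ localContraction J P)
    {a : σ →₀ ℕ} (ha : a ∈ f.support) : monomial a (1 : k) ∈ localContraction J P := by
  obtain ⟨b, hb, hba⟩ := hJ.exists_primePart_eq_zero hf ha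
  exact monomial_mem_localContraction hb hba

/-- The exponents of the monomials in `R ∩ I^(m+1) R_P` are sums of exponents from
`R ∩ I^m R_P` and `R ∩ I R_P`. -/
theorem IsMonomialIdeal.exists_add_of_mem_localContraction_pow_succ
    {I P : Ideal (MvPolynomial σ k)} [P.IsPrime] (hI : IsMonomialIdeal I) {m : ℕ} {v : σ →₀ ℕ}
    (hv : monomial v (1 : k) ∈ localContraction (I ^ (m + 1)) P) :
    ∃ u w, monomial u (1 : k) ∈ localContraction (I ^ m) P ∧
      monomial w (1 : k) ∈ localContraction I P ∧ v = u + w := by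
  obtain ⟨b, hb, hbv⟩ := (hI.pow (m + 1)).exists_primePart_eq_zero hv (mem_support_monomial_one v)
  rw [pow_succ] at hbv
  obtain ⟨p, q, hp, hq, h⟩ := (hI.pow m).exists_add_of_mem_mul hI hbv
  have h' := congrArg (primePart P) h
  rw [primePart_add, primePart_add, hb, zero_add] at h'
  -- Multiplying with monomials outside `P` is immaterial, so only the prime parts count.
  refine ⟨primePart P p + (v - primePart P v), primePart P q,
    monomial_mem_of_le le_self_add (monomial_primePart_mem hp), monomial_primePart_mem hq, ?_⟩
  rw [add_right_comm, ← h', add_tsub_cancel_of_le (primePart_le P v)]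

end PrimePart

/-! ### Convex hulls of lattice points -/

section Convex

/-- An exponent vector as a point of real affine space. -/
def realVector {σ : Type*} (a : σ →₀ ℕ) : σ → ℝ := fun i => a i

theorem realVector_add {σ : Type*} (a b : σ →₀ ℕ) :
    realVector (a + b) = realVector a + realVector b := by
  ext i
  simp [realVector]

theorem latticePoints_eq {σ k : Type*} [Field k] (J : Ideal (MvPolynomial σ k)) :
    latticePoints J = realVector '' {a | monomial a (1 : k) ∈ J} := by
  ext x
  exact ⟨fun ⟨a, ha, h⟩ => ⟨a, ha, h.symm⟩, fun ⟨a, ha, h⟩ => ⟨a, ha, h.symm⟩⟩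

theorem convexHull_range_natCast : convexHull ℝ (Set.range ((↑) : ℕ → ℝ)) = Set.Ici 0 := by
  refine Set.Subset.antisymm (convexHull_min ?_ (convex_Ici 0)) fun x hx => ?_
  · rintro _ ⟨n, rfl⟩
    exact Set.mem_Ici.2 n.cast_nonneg
  · exact (convex_convexHull ℝ _).ordConnected.out
      (subset_convexHull ℝ _ (Set.mem_range.2 ⟨0, Nat.cast_zero⟩))
      (subset_convexHull ℝ _ (Set.mem_range_self ⌈x⌉₊))
      ⟨hx, Nat.le_ceil x⟩

open scoped Pointwise in
/-- By Dickson's lemma, the convex hull of the lattice points of an ideal is the sum of a polytope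
and the non-negative orthant, hence closed. -/
theorem isClosed_convexHull_latticePoints {σ k : Type*} [Finite σ] [Field k]
    (J : Ideal (MvPolynomial σ k)) : IsClosed (convexHull ℝ (latticePoints J)) := by
  set G : Set (σ →₀ ℕ) := {a | Minimal (fun a => monomial a (1 : k) ∈ J) a}
  have hGfin : G.Finite :=
    (setOfPred_minimal_antichain _).finite_of_partiallyWellOrderedOn
      (Set.isPWO_of_wellQuasiOrderedLE G)
  have h : latticePoints J =
      Set.univ.pi (fun _ : σ => Set.range ((↑) : ℕ → ℝ)) + realVector '' G := by
    rw [latticePoints_eq]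
    ext x
    constructor
    · rintro ⟨a, ha, rfl⟩
      obtain ⟨g, hga, hg⟩ := exists_minimal_le_of_wellFoundedLT
        (fun a => monomial a (1 : k) ∈ J) a ha
      refine ⟨realVector (a - g), fun i _ => ⟨(a - g) i, rfl⟩, _, ⟨g, hg, rfl⟩, ?_⟩
      exact (realVector_add _ _).symm.trans (by rw [tsub_add_cancel_of_le hga])
    · rintro ⟨y, hy, _, ⟨g, hg, rfl⟩, rfl⟩
      choose b hb using fun i => hy i (Set.mem_univ i)
      refine ⟨Finsupp.equivFunOnFinite.symm b + g, monomial_mem_of_le le_add_self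
        (show Minimal (fun a => monomial a (1 : k) ∈ J) g from hg).prop, ?_⟩
      ext i
      simp [realVector, hb]
  rw [h, convexHull_add, convexHull_pi]
  refine IsClosed.add_right_of_isCompact ?_ ((hGfin.image _).isCompact_convexHull ℝ)
  simp only [convexHull_range_natCast]
  exact isClosed_set_pi fun _ _ => isClosed_Ici

theorem nonneg_of_mem_convexHull_latticePoints {σ k : Type*} [Field k]
    {J : Ideal (MvPolynomial σ k)} {x : σ → ℝ} (hx : x ∈ convexHull ℝ (latticePoints J)) :
    0 ≤ x := by
  refine convexHull_min (t := Set.Ici 0) ?_ (convex_Ici 0) hx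
  rintro _ ⟨a, -, rfl⟩ i
  exact (a i).cast_nonneg

theorem isLeast_minCoordSum {σ : Type*} [Fintype σ] {Q : Set (σ → ℝ)} (hQ : IsClosed Q)
    (hne : Q.Nonempty) (hnonneg : ∀ x ∈ Q, 0 ≤ x) : IsLeast (coordSums Q) (minCoordSum Q) := by
  obtain ⟨x₀, hx₀⟩ := hne
  have hcont : Continuous fun x : σ → ℝ => ∑ i, x i := by fun_prop
  have hcomp : IsCompact (Q ∩ {x | ∑ i, x i ≤ ∑ i, x₀ i}) := by
    refine IsCompact.of_isClosed_subset (isCompact_Icc (a := 0) (b := fun _ => ∑ i, x₀ i))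
      (hQ.inter (isClosed_le hcont continuous_const)) fun x hx => ⟨hnonneg x hx.1, fun i => ?_⟩
    exact (Finset.single_le_sum (fun j _ => hnonneg x hx.1 j) (Finset.mem_univ i)).trans hx.2
  obtain ⟨y, hy, hmin⟩ := hcomp.exists_isMinOn ⟨x₀, hx₀, le_refl (∑ i, x₀ i)⟩ hcont.continuousOn
  have hleast : IsLeast (coordSums Q) (∑ i, y i) := by
    refine ⟨⟨y, hy.1, rfl⟩, ?_⟩
    rintro _ ⟨x, hx, rfl⟩
    rcases le_total (∑ i, x i) (∑ i, x₀ i) with h | h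
    · exact hmin ⟨hx, h⟩
    · exact hy.2.trans h
  rw [minCoordSum, hleast.csInf_eq]
  exact hleast

/-- If the coordinate sum has a minimum `α` on an intersection of finitely many convex hulls of
sets of lattice points, then for some `N > 0` there is a lattice point of coordinate sum `N * α`
that is, for each of the sets, a sum of `N` of its points. -/
theorem exists_multiset_sum_of_isLeast {σ J : Type*} [Fintype σ] [Finite J] [Nonempty J]
    (S : J → Set (σ →₀ ℕ)) {α : ℝ}
    (hα : IsLeast (coordSums (⋂ j, convexHull ℝ (realVector '' S j))) α) :
    ∃ (N : ℕ) (a : σ →₀ ℕ), 0 < N ∧ ∑ i, (a i : ℝ) = N * α ∧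
      ∀ j, ∃ t : Multiset (σ →₀ ℕ), (∀ v ∈ t, v ∈ S j) ∧ Multiset.card t = N ∧ t.sum = a := by
  obtain ⟨⟨y, hy, rfl⟩, hmin⟩ := hα
  choose ι hι z w hz _ hw hw1 hwy using fun j =>
    eq_pos_convex_span_of_mem_convexHull (Set.mem_iInter.1 hy j)
  choose v hv hvz using fun j i => hz j ⟨i, rfl⟩
  -- Apply a `ℚ`-linear map `φ` to `y` and to all weights `w j i` expressing it.
  set T : Set ℝ := insert 1 (⋃ j, Set.range (w j))
  have hTfin : T.Finite := (Set.finite_iUnion fun j => Set.finite_range (w j)).insert 1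
  have hTpos : ∀ x ∈ T, 0 < x := by
    rintro x (rfl | hx)
    · exact one_pos
    · obtain ⟨j, i, rfl⟩ := Set.mem_iUnion.1 hx
      exact hw j i
  have hwT : ∀ j i, w j i ∈ T := fun j i => Or.inr (Set.mem_iUnion.2 ⟨j, i, rfl⟩)
  obtain ⟨φ, hφ⟩ := exists_linearMap_pos_nat hTfin hTpos
  obtain ⟨ε, hε, hεT⟩ := exists_pos_forall_mul_lt hTfin hTpos fun x => (φ x : ℝ)
  obtain ⟨hφ1, N, hN⟩ := hφ 1 (Or.inl rfl)
  choose c hc using fun j i => (hφ (w j i) (hwT j i)).2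
  have hN0 : 0 < N := by rw [hN] at hφ1; exact_mod_cast hφ1
  have hcN : ∀ j, ∑ i, c j i = N := fun j => by
    have h := congrArg φ (hw1 j)
    rw [map_sum, hN] at h
    simp only [hc] at h
    exact_mod_cast h
  have hφy : ∀ j l, φ (y l) = ((∑ i, c j i • v j i) l : ℕ) := fun j l => by
    rw [← hwy j, Finset.sum_apply, map_sum, Finsupp.finsetSum_apply, Nat.cast_sum]
    refine Finset.sum_congr rfl fun i _ => ?_
    have : (w j i • z j i) l = v j i l • w j i := by
      rw [← hvz, Pi.smul_apply, smul_eq_mul, nsmul_eq_mul, mul_comm]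
      rfl
    rw [this, map_nsmul, hc, nsmul_eq_mul, Finsupp.smul_apply, smul_eq_mul, Nat.cast_mul, mul_comm]
  obtain ⟨j₀⟩ := ‹Nonempty J›
  obtain ⟨a, ha⟩ : ∃ a, ∀ j, ∑ i, c j i • v j i = a := by
    refine ⟨∑ i, c j₀ i • v j₀ i, fun j => Finsupp.ext fun l => ?_⟩
    exact_mod_cast (hφy j l).symm.trans (hφy j₀ l)
  have hreal : ∀ j, ∑ i, (c j i : ℝ) • z j i = realVector a := fun j => by
    ext l
    rw [← ha j, Finset.sum_apply, realVector, Finsupp.finsetSum_apply, Nat.cast_sum]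
    refine Finset.sum_congr rfl fun i _ => ?_
    rw [← hvz]
    simp [realVector]
  have hcone : ∀ (s : ℝ) (x : σ → ℝ), 0 < s → (∀ j, ∃ p : ι j → ℝ, (∀ i, 0 ≤ p i) ∧
      ∑ i, p i = s ∧ ∑ i, p i • z j i = x) → s * ∑ l, y l ≤ ∑ l, x l := by
    intro s x hs hp
    have hmem : s⁻¹ • x ∈ ⋂ j, convexHull ℝ (realVector '' S j) := by
      refine Set.mem_iInter.2 fun j => ?_
      obtain ⟨p, hp0, rfl, rfl⟩ := hp j
      exact Finset.centerMass_mem_convexHull _ (fun i _ => hp0 i) hs fun i _ => hz j ⟨i, rfl⟩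
    have := hmin ⟨_, hmem, rfl⟩
    simp only [Pi.smul_apply, smul_eq_mul, ← Finset.mul_sum] at this
    rwa [← div_eq_inv_mul, le_div_iff₀ hs, mul_comm] at this
  have hge : N * ∑ l, y l ≤ ∑ l, realVector a l := by
    refine hcone N _ (by exact_mod_cast hN0) fun j =>
      ⟨fun i => c j i, fun i => Nat.cast_nonneg _, ?_, hreal j⟩
    rw [← hcN j, Nat.cast_sum]
  -- The point `y - ε • a` still lies in the cone over the polyhedron, so minimality of `y` bounds
  -- the coordinate sum of `a` from above as well.
  have hle : (1 - ε * N) * ∑ l, y l ≤ ∑ l, (y - ε • realVector a) l := by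
    refine hcone _ _ ?_ fun j => ⟨fun i => w j i - ε * c j i, fun i => ?_, ?_, ?_⟩
    · have := hεT 1 (Or.inl rfl)
      rw [hN] at this
      push_cast at this
      linarith
    · have := hεT _ (hwT j i)
      rw [hc] at this
      push_cast at this
      linarith
    · rw [Finset.sum_sub_distrib, hw1, ← Finset.mul_sum, ← hcN j, Nat.cast_sum]
    · simp only [sub_smul, mul_smul]
      rw [Finset.sum_sub_distrib, hwy, ← Finset.smul_sum, hreal]
  simp only [Pi.sub_apply, Pi.smul_apply, smul_eq_mul, Finset.sum_sub_distrib,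
    ← Finset.mul_sum] at hle
  have hle' : ε * ∑ l, realVector a l ≤ ε * (N * ∑ l, y l) := by linarith
  refine ⟨N, a, hN0, le_antisymm (le_of_mul_le_mul_left hle' hε) hge, fun j =>
    ⟨∑ i, Multiset.replicate (c j i) (v j i), fun u hu => ?_, ?_, ?_⟩⟩
  · obtain ⟨i, -, hi⟩ := Multiset.mem_sum.1 hu
    rw [Multiset.eq_of_mem_replicate hi]
    exact hv j i
  · rw [Multiset.card_sum]
    simpa using hcN j
  · rw [← ha j, ← Multiset.coe_sumAddMonoidHom, map_sum]
    simp

end Convex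

/-! ### The symbolic polyhedron and symbolic powers -/

section Main

variable {σ k : Type*} [Field k]

theorem monomial_multiset_sum_mem_pow {J : Ideal (MvPolynomial σ k)} (t : Multiset (σ →₀ ℕ))
    (ht : ∀ v ∈ t, monomial v (1 : k) ∈ J) :
    monomial t.sum (1 : k) ∈ J ^ Multiset.card t := by
  induction t using Multiset.induction_on with
  | empty => simp
  | cons a t ih =>
    rw [Multiset.sum_cons, Multiset.card_cons, pow_succ', ← one_mul (1 : k), ← monomial_mul]
    exact Ideal.mul_mem_mul (ht a (Multiset.mem_cons_self a t))
      (ih fun v hv => ht v (Multiset.mem_cons_of_mem hv))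

open scoped Pointwise in
theorem IsMonomialIdeal.realVector_mem_smul {I P : Ideal (MvPolynomial σ k)} [P.IsPrime]
    (hI : IsMonomialIdeal I) {m : ℕ} {v : σ →₀ ℕ}
    (hv : monomial v (1 : k) ∈ localContraction (I ^ (m + 1)) P) :
    realVector v ∈ ((m + 1 : ℕ) : ℝ) • convexHull ℝ (latticePoints (localContraction I P)) := by
  have hsub : ∀ v, monomial v (1 : k) ∈ localContraction I P →
      realVector v ∈ convexHull ℝ (latticePoints (localContraction I P)) := fun v hv =>
    subset_convexHull ℝ _ ⟨v, hv, rfl⟩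
  induction m generalizing v with
  | zero => simpa using hsub v (by simpa using hv)
  | succ m ih =>
    obtain ⟨u, w, hu, hw, rfl⟩ := hI.exists_add_of_mem_localContraction_pow_succ hv
    rw [Nat.cast_succ (m + 1), (convex_convexHull ℝ _).add_smul (Nat.cast_nonneg _) zero_le_one,
      one_smul, realVector_add]
    exact Set.add_mem_add (ih hu) (hsub w hw)

theorem isClosed_symbolicPolyhedron [Finite σ] (I : Ideal (MvPolynomial σ k)) :
    IsClosed (symbolicPolyhedron I) :=
  isClosed_iInter fun _ => isClosed_iInter fun _ => isClosed_convexHull_latticePoints _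

theorem IsMonomialIdeal.nonempty_symbolicPolyhedron {I : Ideal (MvPolynomial σ k)}
    (hI : IsMonomialIdeal I) (hI0 : I ≠ ⊥) : (symbolicPolyhedron I).Nonempty := by
  obtain ⟨a, ha⟩ := hI.exists_monomial_mem hI0
  refine ⟨realVector a, Set.mem_iInter₂.2 fun P hP => subset_convexHull ℝ _ ⟨a, ?_, rfl⟩⟩
  have := isPrime_of_mem_maxAss hP
  exact le_localContraction I P ha

theorem nonneg_of_mem_symbolicPolyhedron [Finite σ] {I : Ideal (MvPolynomial σ k)} (hI1 : I ≠ ⊤)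
    {x : σ → ℝ} (hx : x ∈ symbolicPolyhedron I) : 0 ≤ x := by
  obtain ⟨P, hP⟩ := nonempty_maxAss hI1
  exact nonneg_of_mem_convexHull_latticePoints (Set.mem_iInter₂.1 hx P hP)

theorem IsMonomialIdeal.isLeast_minCoordSum_symbolicPolyhedron [Fintype σ]
    {I : Ideal (MvPolynomial σ k)} (hI : IsMonomialIdeal I) (hI0 : I ≠ ⊥) (hI1 : I ≠ ⊤) :
    IsLeast (coordSums (symbolicPolyhedron I)) (minCoordSum (symbolicPolyhedron I)) :=
  isLeast_minCoordSum (isClosed_symbolicPolyhedron I) (hI.nonempty_symbolicPolyhedron hI0)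
    fun _ => nonneg_of_mem_symbolicPolyhedron hI1

theorem degree_mem_formDegrees {J : Ideal (MvPolynomial σ k)} {a : σ →₀ ℕ}
    (ha : monomial a (1 : k) ∈ J) : a.degree ∈ formDegrees J :=
  ⟨_, ha, by simp, isHomogeneous_monomial 1 rfl⟩

theorem IsMonomialIdeal.isLeast_initialDegree_symbolicPower [Finite σ]
    {I : Ideal (MvPolynomial σ k)} (hI : IsMonomialIdeal I) (hI0 : I ≠ ⊥) (m : ℕ) :
    IsLeast (formDegrees (symbolicPower I m)) (initialDegree (symbolicPower I m)) := by
  obtain ⟨a, ha⟩ := (hI.pow m).exists_monomial_mem (pow_ne_zero m hI0)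
  have hne : (formDegrees (symbolicPower I m)).Nonempty :=
    ⟨_, degree_mem_formDegrees (pow_le_symbolicPower I m ha)⟩
  exact ⟨Nat.sInf_mem hne, fun d hd => Nat.sInf_le hd⟩

/-- The exponents of all monomials occurring in `I^(m)`, divided by `m`, lie in the symbolic
polyhedron. -/
theorem IsMonomialIdeal.inv_smul_realVector_mem_symbolicPolyhedron [Finite σ]
    {I : Ideal (MvPolynomial σ k)} (hI : IsMonomialIdeal I) {m : ℕ} {f : MvPolynomial σ k}
    (hf : f ∈ symbolicPower I (m + 1)) {v : σ →₀ ℕ} (hv : v ∈ f.support) :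
    ((m + 1 : ℕ) : ℝ)⁻¹ • realVector v ∈ symbolicPolyhedron I := by
  refine Set.mem_iInter₂.2 fun P hP => ?_
  have := isPrime_of_mem_maxAss hP
  rw [← Set.mem_smul_set_iff_inv_smul_mem₀ (Nat.cast_ne_zero.2 m.succ_ne_zero)]
  exact hI.realVector_mem_smul
    ((hI.pow _).monomial_mem_localContraction_of_mem (mem_symbolicPower.1 hf P hP) hv)

theorem IsMonomialIdeal.mul_minCoordSum_le_initialDegree [Fintype σ]
    {I : Ideal (MvPolynomial σ k)} (hI : IsMonomialIdeal I) (hI0 : I ≠ ⊥) (hI1 : I ≠ ⊤) (m : ℕ) :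
    m * minCoordSum (symbolicPolyhedron I) ≤ initialDegree (symbolicPower I m) := by
  rcases m with _ | m
  · simp
  obtain ⟨f, hf, hf0, hfd⟩ := (hI.isLeast_initialDegree_symbolicPower hI0 (m + 1)).1
  obtain ⟨v, hv⟩ := Finset.nonempty_of_ne_empty (mt support_eq_empty.1 hf0)
  have hle := (hI.isLeast_minCoordSum_symbolicPolyhedron hI0 hI1).2
    ⟨_, hI.inv_smul_realVector_mem_symbolicPolyhedron hf hv, rfl⟩
  have hdeg : ∑ i, realVector v i = initialDegree (symbolicPower I (m + 1)) := by
    rw [← hfd (mem_support_iff.1 hv), Pi.one_def, ← Finsupp.degree_eq_weight_one,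
      Finsupp.degree_eq_sum, Nat.cast_sum]
    rfl
  simp only [Pi.smul_apply, smul_eq_mul, ← Finset.mul_sum, hdeg] at hle
  rwa [← div_eq_inv_mul, le_div_iff₀ (Nat.cast_pos.2 m.succ_pos), mul_comm] at hle

/-- A rational point `a / N` minimizing the coordinate sum on the symbolic polyhedron, such that
the monomial `x^a` lies in `(R ∩ I R_P)^N` for every maximal associated prime `P`. -/
theorem IsMonomialIdeal.exists_monomial_mem_localContraction_pow [Fintype σ]
    {I : Ideal (MvPolynomial σ k)} (hI : IsMonomialIdeal I) (hI0 : I ≠ ⊥) (hI1 : I ≠ ⊤) :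
    ∃ (N : ℕ) (a : σ →₀ ℕ), 0 < N ∧ (a.degree : ℝ) = N * minCoordSum (symbolicPolyhedron I) ∧
      ∀ (P : Ideal (MvPolynomial σ k)) (hP : P ∈ maxAss I),
        haveI : P.IsPrime := isPrime_of_mem_maxAss hP
        monomial a (1 : k) ∈ localContraction I P ^ N := by
  have := (finite_maxAss I).to_subtype
  have := (nonempty_maxAss hI1).to_subtype
  let S : maxAss I → Set (σ →₀ ℕ) := fun P =>
    haveI : P.1.IsPrime := isPrime_of_mem_maxAss P.2
    {a | monomial a (1 : k) ∈ localContraction I P.1}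
  have hS : symbolicPolyhedron I = ⋂ P, convexHull ℝ (realVector '' S P) := by
    rw [Set.iInter_subtype]
    simp only [symbolicPolyhedron, latticePoints_eq, S]
  have hleast := hI.isLeast_minCoordSum_symbolicPolyhedron hI0 hI1
  obtain ⟨N, a, hN, ha, ht⟩ := exists_multiset_sum_of_isLeast S (hS ▸ hleast)
  refine ⟨N, a, hN, ?_, fun P hP => ?_⟩
  · rw [hS, ← ha, Finsupp.degree_eq_sum, Nat.cast_sum]
  · obtain ⟨t, htS, rfl, rfl⟩ := ht ⟨P, hP⟩
    exact monomial_multiset_sum_mem_pow t htS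

theorem IsMonomialIdeal.infinite_setOf_initialDegree_eq [Fintype σ]
    {I : Ideal (MvPolynomial σ k)} (hI : IsMonomialIdeal I) (hI0 : I ≠ ⊥) (hI1 : I ≠ ⊤) :
    {m : ℕ | (initialDegree (symbolicPower I m) : ℝ) =
      m * minCoordSum (symbolicPolyhedron I)}.Infinite := by
  obtain ⟨N, a, hN, ha, haP⟩ := hI.exists_monomial_mem_localContraction_pow hI0 hI1
  refine Set.infinite_of_injective_forall_mem (f := fun j : ℕ => N * j)
    (mul_right_injective₀ hN.ne') fun j => le_antisymm ?_
    (hI.mul_minCoordSum_le_initialDegree hI0 hI1 _)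
  have hmem : monomial (j • a) (1 : k) ∈ symbolicPower I (N * j) := by
    refine mem_symbolicPower.2 fun P hP => ?_
    have := isPrime_of_mem_maxAss hP
    refine localContraction_pow_le I P _ ?_
    rw [pow_mul, ← one_pow j, ← monomial_pow]
    exact Ideal.pow_mem_pow (haP P hP) j
  have hle := (hI.isLeast_initialDegree_symbolicPower hI0 (N * j)).2 (degree_mem_formDegrees hmem)
  calc (initialDegree (symbolicPower I (N * j)) : ℝ) ≤ ((j • a).degree : ℕ) := by exact_mod_cast hle
    _ = j * (a.degree : ℝ) := by rw [map_nsmul, smul_eq_mul, Nat.cast_mul]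
    _ = (N * j : ℕ) * minCoordSum (symbolicPolyhedron I) := by rw [ha]; push_cast; ring

end Main

end SymbolicPolyhedron

/-- The first two conclusions say that the minima defining `α(𝒬)` and `α(I^(m))` exist. -/
theorem mainTheorem4 {k : Type*} [Field k] (n : ℕ)
    (I : Ideal (MvPolynomial (Fin (n + 1)) k))
    (hI : SymbolicPolyhedron.IsMonomialIdeal I) (hI0 : I ≠ ⊥) (hI1 : I ≠ ⊤) :
    IsLeast (SymbolicPolyhedron.coordSums (SymbolicPolyhedron.symbolicPolyhedron I))
      (SymbolicPolyhedron.minCoordSum (SymbolicPolyhedron.symbolicPolyhedron I)) ∧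
    (∀ m : ℕ, IsLeast (SymbolicPolyhedron.formDegrees (SymbolicPolyhedron.symbolicPower I m))
      (SymbolicPolyhedron.initialDegree (SymbolicPolyhedron.symbolicPower I m))) ∧
    (∀ m : ℕ, (SymbolicPolyhedron.initialDegree (SymbolicPolyhedron.symbolicPower I m) : ℝ) ≥
      m * SymbolicPolyhedron.minCoordSum (SymbolicPolyhedron.symbolicPolyhedron I)) ∧
    {m : ℕ | (SymbolicPolyhedron.initialDegree (SymbolicPolyhedron.symbolicPower I m) : ℝ) =
      m * SymbolicPolyhedron.minCoordSum (SymbolicPolyhedron.symbolicPolyhedron I)}.Infinite := by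
  exact ⟨hI.isLeast_minCoordSum_symbolicPolyhedron hI0 hI1,
    hI.isLeast_initialDegree_symbolicPower hI0, hI.mul_minCoordSum_le_initialDegree hI0 hI1,
    hI.infinite_setOf_initialDegree_eq hI0 hI1⟩
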